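/- Let $n\ge 1$. A \emph{signed graph} $G$ on the vertex set $[n+1]=\{1,\dots,n+1\}$ is a finite multiset of $N$ edges, each of which is a negative edge $(i,j,-)$ with $i<j$ or a positive edge $(i,j,+)$ with $i\le j$ (a loop if $i=j$). Put $\mathrm v(i,j,-)=\mathbf e_i-\mathbf e_j$ and $\mathrm v(i,j,+)=\mathbf e_i+\mathbf e_j$ (so $\mathrm v(i,i,+)=2\mathbf e_i$), and let $M_G$ be the $(n+1)\times N$ matrix whose columns are the vectors $\mathrm v(e)$ for the edges $e$ of $G$, with multiplicity. For $\mathbf a\in\mathbb Z^{n+1}$ the \emph{flow polytope} is $\mathcal F_G(\mathbf a)=\{f\in\mathbb R_{\ge 0}^{N} : M_G f=\mathbf a\}$. For an integer polytope $P\subset\mathbb R^N$ of dimension $d$, the \emph{normalized volume} $\mathrm{vol}(P)$ is $d!$ times the volume of $P$ with respect to the lattice of integer points in its affine span, so that a smallest $d$-dimensional integer simplex in the affine span has volume $1$. Let $K^C_{n+1}$ be the signed graph on $[n+1]$ that has each of the edges $(i,j,+)$, $(i,j,-)$ for $1\le i<j\le n+1$ and each of the loops $(i,i,+)$ for $1\le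 i\le n+1$ exactly once, and let $CRYC_{n+1}=\mathcal F_{K^C_{n+1}}(2,0,\dots,0)$. For $2\le v\le n+1$ and $1\le k\le v-1$ let $S^{(v)}_k$ be the multiset of edges $$S_k^{(v)}=\{(i,v,+),(i,v,+)\mid 1\le i\le k-1\}\cup\{(k,v,+),(k,v,+),(k,v,-)\}\cup\{(i,v,+),(i,v,-)\mid k+1\le i\le v-1\},$$ and let $$\mathcal G=\Big\{G=\Big([n+1],\ \bigcup_{v=2}^{n+1}S^{(v)}_{i_v}\Big)\ \Big|\ i_v\in[v-1]\text{ for each } v\in\{2,\dots,n+1\}\Big\}.$$ Then $$\mathrm{vol}(CRYC_{n+1})=\sum_{G\in\mathcal G}\mathrm{vol}\big(\mathcal F_G(2,0,\dots,0)\big).$$ -/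

import Mathlib

open MeasureTheory
open scoped Nat

/-- The possible edges of a signed graph on `n + 1` vertices. The vertex set `{1, …, n+1}` is
modelled by `Fin (n + 1)`, so that the vertex called `v` in the literature is `v - 1` here.
`neg i j` is the negative edge `(i, j, -)` with `i < j`; `pos i j` is the positive edge
`(i, j, +)` with `i ≤ j`, a loop if `i = j` (loops are always positive). -/
inductive SignedEdge (n : ℕ) : Type
  | neg (i j : Fin (n + 1)) (h : i < j) : SignedEdge n
  | pos (i j : Fin (n + 1)) (h : i ≤ j) : SignedEdge n
  deriving DecidableEq, Fintype

/-- The positive type `C` root of an edge: `e_i - e_j` for `(i, j, -)`, and `e_i + e_j` for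
`(i, j, +)` (hence `2 e_i` for a loop at `i`). -/
def SignedEdge.root {n : ℕ} : SignedEdge n → Fin (n + 1) → ℤ
  | .neg i j _ => Pi.single i 1 - Pi.single j 1
  | .pos i j _ => Pi.single i 1 + Pi.single j 1

/-- A signed graph on `n + 1` vertices, given by its multiset of edges. -/
abbrev SignedGraph (n : ℕ) : Type := Multiset (SignedEdge n)

/-- The matrix `M_G`: its columns are indexed by the edges of `G`, listed with multiplicity,
and the column of an edge is its root. -/
def SignedGraph.matrix {n : ℕ} (G : SignedGraph n) : Matrix (Fin (n + 1)) G.ToType ℝ :=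
  Matrix.of fun v e => (e.1.root v : ℝ)

/-- The flow polytope `F_G(a)`: all nonnegative real flows on the edges of `G` (with
multiplicity) with netflow vector `a`. -/
def SignedGraph.flowPolytope {n : ℕ} (G : SignedGraph n) (a : Fin (n + 1) → ℤ) :
    Set (G.ToType → ℝ) :=
  {f | (∀ e, 0 ≤ f e) ∧ (G.matrix).mulVec f = fun v => (a v : ℝ)}

/-- The lattice of integer points of a linear subspace of `ℝ^ι`. -/
def integerPoints {ι : Type} (V : Submodule ℝ (ι → ℝ)) : Submodule ℤ V where
  carrier := {x | ∀ i, ∃ k : ℤ, (x : ι → ℝ) i = k}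
  add_mem' := by
    intro x y hx hy i
    obtain ⟨k, hk⟩ := hx i
    obtain ⟨l, hl⟩ := hy i
    exact ⟨k + l, by simp [hk, hl]⟩
  zero_mem' := fun _ => ⟨0, by simp⟩
  smul_mem' := by
    intro c x hx i
    obtain ⟨k, hk⟩ := hx i
    exact ⟨c * k, by simp [hk]⟩

open Classical in
/-- The normalized volume of an integer polytope `P` in `ℝ^ι`. Let `V` be the direction of the
affine span of `P` and `d = dim V`. The polytope, translated into `V` by one of its points, is
measured by the Haar measure of `V` that gives volume one to a fundamental domain of the lattice
of integer points of `V`, and the result is multiplied by `d!`, so that the smallest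
`d`-dimensional integer simplices have volume one. (`Measure.addHaar` is some Haar measure of `V`;
its choice cancels in the quotient, and by translation invariance so does the base point.)
The empty set has volume zero. -/
noncomputable def normalizedVolume {ι : Type} [Fintype ι] (P : Set (ι → ℝ)) : ℝ :=
  if h : P.Nonempty then
    (Module.finrank ℝ (vectorSpan ℝ P))! *
      ((Measure.addHaar : Measure (vectorSpan ℝ P)).real
          {x | (x : ι → ℝ) + h.some ∈ P} /
        ZLattice.covolume (integerPoints (vectorSpan ℝ P)) Measure.addHaar)
  else 0

/-- The netflow vector `(2, 0, …, 0)`. -/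
def netflowTwo (n : ℕ) : Fin (n + 1) → ℤ := Pi.single 0 2

/-- The complete signed graph `K^C_{n+1}`: each of the edges `(i, j, -)`, `(i, j, +)` with
`i < j` and each of the loops `(i, i, +)`, exactly once. -/
def completeGraphC (n : ℕ) : SignedGraph n := (Finset.univ : Finset (SignedEdge n)).val

/-- The type `C` Chan-Robbins-Yuen polytope `CRYC_{n+1} = F_{K^C_{n+1}}(2, 0, …, 0)`. -/
def CRYC (n : ℕ) : Set ((completeGraphC n).ToType → ℝ) :=
  (completeGraphC n).flowPolytope (netflowTwo n)

/-- The vertex `i` of the graph, for `i` one of the vertices that precede `v.succ`. -/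
def earlierVertex {n : ℕ} (v : Fin n) (i : Fin (v + 1)) : Fin (n + 1) :=
  ⟨i, lt_of_lt_of_le i.isLt (Nat.succ_le_succ v.isLt.le)⟩

theorem earlierVertex_lt {n : ℕ} (v : Fin n) (i : Fin (v + 1)) :
    earlierVertex v i < v.succ := by
  simp only [Fin.lt_def, earlierVertex, Fin.val_succ]
  exact i.isLt

/-- The edges between the vertex `v.succ` and the earlier vertices in the multiset `S_k`, where
`k` is one of the earlier vertices: `(i, +), (i, +)` for `i < k`, `(k, +), (k, +), (k, -)`, and
`(i, +), (i, -)` for `i > k`. As `v` runs through `Fin n`, `v.succ` runs through all vertices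
but the first. -/
def edgeSetS {n : ℕ} (v : Fin n) (k : Fin (v + 1)) : SignedGraph n :=
  ∑ i : Fin (v + 1),
    let p : SignedEdge n := .pos (earlierVertex v i) v.succ (earlierVertex_lt v i).le
    let m : SignedEdge n := .neg (earlierVertex v i) v.succ (earlierVertex_lt v i)
    if i < k then {p, p} else if i = k then {p, p, m} else {p, m}

/-- The family of the graphs with edge multiset `⋃_v S^{(v)}_{i_v}` (a union of multisets that
have no edge in common), one for each choice of a vertex `i_v` before `v` for each vertex `v`
but the first. -/
def graphFamily (n : ℕ) : Finset (SignedGraph n) :=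
  (Finset.univ : Finset ((v : Fin n) → Fin (v + 1))).image fun i => ∑ v : Fin n, edgeSetS v (i v)

/-! The edge `(i, v, +)` has the same root as `(i, v, -)` followed by the loop at `v`. Rerouting
along this relation maps the flows on the graph with choices `k` unimodularly onto the chamber
`∑_{j < k v} f(j, v, -) ≤ f(v, v, +) ≤ ∑_{j ≤ k v} f(j, v, -)` of the flow polytope of `K^C` without
the loop at the first vertex. These chambers subdivide that polytope, because the netflow at a
vertex `v` other than the first is zero and so the flow on the loop at `v` is at most the total flow
on the negative edges into `v`. The loop at the first vertex makes `CRYC` a pyramid of lattice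
height one over the subdivided polytope. Normalized volume is invariant under unimodular maps,
additive over subdivisions, and unchanged by such pyramids. -/

section NormalizedVolume

/-- The points of the lattice `ℤ^ι` in `ℝ^ι`. -/
def IsIntegerVector {ι : Type*} (x : ι → ℝ) : Prop := ∀ i, ∃ k : ℤ, x i = k

/-- A unimodular map is an injective linear map which identifies the integer points of its domain
with the integer points of its range. -/
structure IsUnimodular {ι κ : Type*} (f : (ι → ℝ) →ₗ[ℝ] κ → ℝ) : Prop where
  injective : Function.Injective f
  isIntegerVector_iff : ∀ x, IsIntegerVector (f x) ↔ IsIntegerVector x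

theorem IsUnimodular.comp {ι κ τ : Type*} {g : (κ → ℝ) →ₗ[ℝ] τ → ℝ} {f : (ι → ℝ) →ₗ[ℝ] κ → ℝ}
    (hg : IsUnimodular g) (hf : IsUnimodular f) : IsUnimodular (g ∘ₗ f) where
  injective := hg.injective.comp hf.injective
  isIntegerVector_iff x := (hg.isIntegerVector_iff _).trans (hf.isIntegerVector_iff x)

variable {ι κ : Type} [Fintype ι] [Fintype κ]

omit [Fintype ι] in
instance discreteTopology_integerPoints [Finite ι] (V : Submodule ℝ (ι → ℝ)) :
    DiscreteTopology (integerPoints V) := by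
  classical
  have := Fintype.ofFinite ι
  let Λ := Submodule.span ℤ (Set.range (Pi.basisFun ℝ ι))
  have hΛ : integerPoints V = ZLattice.comap ℝ Λ V.subtype := by
    ext x
    refine Iff.trans ?_ (Module.Basis.mem_span_iff_repr_mem ℤ (Pi.basisFun ℝ ι) _).symm
    exact forall_congr' fun i => by simp [eq_comm]
  rw [hΛ]
  exact ZLattice.comap_discreteTopology ℝ Λ continuous_subtype_val V.injective_subtype

theorem exists_isUnimodular_range_eq (V : Submodule ℝ (ι → ℝ)) [IsZLattice ℝ (integerPoints V)] :
    ∃ g : (Fin (Module.finrank ℝ V) → ℝ) →ₗ[ℝ] ι → ℝ, IsUnimodular g ∧ LinearMap.range g = V := by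
  have : Module.Free ℤ (integerPoints V) := ZLattice.module_free ℝ _
  have : Module.Finite ℤ (integerPoints V) := ZLattice.module_finite ℝ _
  let z := Module.finBasisOfFinrankEq ℤ (integerPoints V) (ZLattice.rank ℝ (integerPoints V))
  let b := z.ofZLatticeBasis ℝ
  refine ⟨V.subtype ∘ₗ b.equivFun.symm.toLinearMap,
    ⟨V.injective_subtype.comp b.equivFun.symm.injective, fun x => ?_⟩, ?_⟩
  · change b.equivFun.symm x ∈ integerPoints V ↔ _
    rw [← z.ofZLatticeBasis_span ℝ (integerPoints V), Module.Basis.mem_span_iff_repr_mem]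
    refine forall_congr' fun i => ?_
    rw [← Module.Basis.equivFun_apply, LinearEquiv.apply_symm_apply]
    simp [eq_comm]
  · rw [LinearMap.range_comp, LinearEquiv.range, Submodule.map_subtype_top]

theorem addHaar_real_div_covolume {V : Type*} [NormedAddCommGroup V]
    [NormedSpace ℝ V] [MeasurableSpace V] [BorelSpace V]
    (μ : Measure V) [μ.IsAddHaarMeasure] (b : Module.Basis κ ℝ V) (S : Set V) :
    μ.real S / ZLattice.covolume (Submodule.span ℤ (Set.range b)) μ
      = volume.real (b.equivFun.symm ⁻¹' S) := by
  have : FiniteDimensional ℝ V := b.finiteDimensional_of_finite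
  have hcovolume : ZLattice.covolume (Submodule.span ℤ (Set.range b)) μ
      = μ.real (parallelepiped b) :=
    (ZLattice.covolume_eq_measure_fundamentalDomain _ _ (ZSpan.isAddFundamentalDomain b μ)).trans
      (measureReal_congr (ZSpan.fundamentalDomain_ae_parallelepiped b μ))
  have hμ : μ = μ (parallelepiped b) • b.addHaar := by
    rw [b.addHaar_def]
    exact Measure.addHaarMeasure_unique μ b.parallelepiped
  have hvolume : b.addHaar = volume.map b.equivFun.symm.toContinuousLinearEquiv := by
    rw [← addHaarMeasure_eq_volume_pi, ← Module.Basis.parallelepiped_basisFun,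
      ← Module.Basis.addHaar_def, Module.Basis.map_addHaar]
    congr
    classical
    ext i
    simp [Pi.single_apply]
  have hS : b.addHaar S = volume (b.equivFun.symm ⁻¹' S) := by
    rw [hvolume]
    exact b.equivFun.symm.toContinuousLinearEquiv.toHomeomorph.toMeasurableEquiv.map_apply S
  have hμS : μ.real S = μ.real (parallelepiped b) * volume.real (b.equivFun.symm ⁻¹' S) := by
    simp only [Measure.real]
    rw [congrArg (· S) hμ, Measure.smul_apply, hS, smul_eq_mul, ENNReal.toReal_mul]
  rw [hμS, hcovolume, mul_div_cancel_left₀ _ (hcovolume ▸ ZLattice.covolume_ne_zero _ μ)]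

theorem normalizedVolume_eq_of_isUnimodular {P : Set (ι → ℝ)} {g : (κ → ℝ) →ₗ[ℝ] ι → ℝ}
    (hg : IsUnimodular g) (hrange : LinearMap.range g = vectorSpan ℝ P) {p : ι → ℝ}
    (hp : ∀ q ∈ P, q - p ∈ vectorSpan ℝ P) :
    normalizedVolume P = (Fintype.card κ)! * volume.real {x | g x + p ∈ P} := by
  rw [normalizedVolume]
  split_ifs with hne
  · obtain ⟨y, hy⟩ : hne.some - p ∈ LinearMap.range g := hrange ▸ hp _ hne.some_mem
    generalize hne.some = q at hy ⊢
    obtain rfl : q = g y + p := by rw [hy, sub_add_cancel]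
    let b := Module.Basis.ofEquivFun
      ((LinearEquiv.ofInjective g hg.injective).trans (LinearEquiv.ofEq _ _ hrange)).symm
    have hb : ∀ x, (b.equivFun.symm x : ι → ℝ) = g x := fun x => by
      rw [Module.Basis.equivFun_ofEquivFun, LinearEquiv.symm_symm]
      rfl
    have hspan : integerPoints (vectorSpan ℝ P) = Submodule.span ℤ (Set.range b) := by
      ext x
      obtain ⟨z, rfl⟩ := b.equivFun.symm.surjective x
      rw [Module.Basis.mem_span_iff_repr_mem]
      refine Iff.trans (b := IsIntegerVector z) ?_ (forall_congr' fun i => ?_)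
      · rw [← hg.isIntegerVector_iff, ← hb]
        rfl
      · rw [← Module.Basis.equivFun_apply, LinearEquiv.apply_symm_apply]
        simp [eq_comm]
    have hpreimage : b.equivFun.symm ⁻¹' {x | (x : ι → ℝ) + (g y + p) ∈ P}
        = (· + y) ⁻¹' {x | g x + p ∈ P} := by
      ext x
      simp only [Set.mem_preimage, Set.mem_ofPred_eq, hb, map_add, add_assoc]
    rw [hspan, addHaar_real_div_covolume, Module.finrank_eq_card_basis b, hpreimage, Measure.real,
      measure_preimage_add_right, Measure.real]
  · simp [Set.not_nonempty_iff_eq_empty.1 hne]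

theorem normalizedVolume_image {P : Set (ι → ℝ)} [IsZLattice ℝ (integerPoints (vectorSpan ℝ P))]
    {f : (ι → ℝ) →ₗ[ℝ] κ → ℝ} (hf : IsUnimodular f) :
    normalizedVolume (f '' P) = normalizedVolume P := by
  obtain rfl | ⟨p, hp⟩ := P.eq_empty_or_nonempty
  · simp [normalizedVolume]
  obtain ⟨g, hg, hrange⟩ := exists_isUnimodular_range_eq (vectorSpan ℝ P)
  have hspan : vectorSpan ℝ (f '' P) = (vectorSpan ℝ P).map f :=
    f.toAffineMap.map_vectorSpan.symm
  have hmem : ∀ q ∈ P, q - p ∈ vectorSpan ℝ P := fun q hq => vsub_mem_vectorSpan ℝ hq hp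
  rw [normalizedVolume_eq_of_isUnimodular hg hrange hmem,
    normalizedVolume_eq_of_isUnimodular (p := f p) (hf.comp hg)
      (by rw [LinearMap.range_comp, hrange, hspan])]
  · simp only [LinearMap.comp_apply, ← map_add, hf.injective.mem_set_image]
  · rintro _ ⟨q, hq, rfl⟩
    rw [hspan, ← map_sub]
    exact Submodule.mem_map_of_mem (hmem q hq)

omit [Fintype ι] [Fintype κ] in
theorem isCompact_setOf_add_mem [Finite κ] {P : Set (ι → ℝ)} (hP : IsCompact P)
    {g : (κ → ℝ) →ₗ[ℝ] ι → ℝ} (hg : Function.Injective g) (p : ι → ℝ) :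
    IsCompact {x | g x + p ∈ P} :=
  ((Homeomorph.addRight p).isClosedEmbedding.comp
    (LinearMap.isClosedEmbedding_of_injective (LinearMap.ker_eq_bot.2 hg))).isCompact_preimage hP

theorem volume_eq_zero_of_vectorSpan_ne_top {S : Set (κ → ℝ)} (hS : vectorSpan ℝ S ≠ ⊤) :
    volume S = 0 := by
  refine measure_mono_null (subset_affineSpan ℝ S) (Measure.addHaar_affineSubspace _ _ fun h => ?_)
  rw [← direction_affineSpan, h, AffineSubspace.direction_top] at hS
  exact hS rfl

omit [Fintype ι] [Fintype κ] in
theorem map_vectorSpan_setOf_add_mem_le (g : (κ → ℝ) →ₗ[ℝ] ι → ℝ) (p : ι → ℝ) (P : Set (ι → ℝ)) :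
    (vectorSpan ℝ {x | g x + p ∈ P}).map g ≤ vectorSpan ℝ P := by
  rw [vectorSpan_def, Submodule.map_span_le]
  rintro _ ⟨x, hx, y, hy, rfl⟩
  have hx' : g x + p ∈ P := hx
  simpa using vsub_mem_vectorSpan ℝ hx' hy

theorem normalizedVolume_iUnion {K : Type*} [Fintype K] {P : K → Set (ι → ℝ)}
    {V : Submodule ℝ (ι → ℝ)} [IsZLattice ℝ (integerPoints V)] (hP : ∀ k, IsCompact (P k))
    (hspan : ∀ k, vectorSpan ℝ (P k) = V) (hunion : vectorSpan ℝ (⋃ k, P k) = V)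
    (hinter : Pairwise fun k l => vectorSpan ℝ (P k ∩ P l) ≠ V) :
    normalizedVolume (⋃ k, P k) = ∑ k, normalizedVolume (P k) := by
  obtain hempty | ⟨p, hp⟩ := (⋃ k, P k).eq_empty_or_nonempty
  · have hP : ∀ k, P k = ∅ := fun k => Set.subset_empty_iff.1 (hempty ▸ Set.subset_iUnion P k)
    simp [normalizedVolume, hP]
  obtain ⟨g, hg, hrange⟩ := exists_isUnimodular_range_eq V
  have hmem : ∀ q ∈ ⋃ k, P k, q - p ∈ V := fun q hq => hunion ▸ vsub_mem_vectorSpan ℝ hq hp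
  have hcompact : ∀ k, IsCompact {x | g x + p ∈ P k} := fun k =>
    isCompact_setOf_add_mem (hP k) hg.injective p
  have hpreimage : {x | g x + p ∈ ⋃ k, P k} = ⋃ k, {x | g x + p ∈ P k} := by
    ext x
    simp
  have hnull : Pairwise fun k l => AEDisjoint volume {x | g x + p ∈ P k} {x | g x + p ∈ P l} := by
    intro k l hkl
    refine volume_eq_zero_of_vectorSpan_ne_top fun htop => hinter hkl (le_antisymm ?_ ?_)
    · exact hspan k ▸ vectorSpan_mono ℝ Set.inter_subset_left
    · rw [← hrange, LinearMap.range_eq_map, ← htop]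
      exact map_vectorSpan_setOf_add_mem_le g p (P k ∩ P l)
  rw [normalizedVolume_eq_of_isUnimodular hg (hrange.trans hunion.symm) (hunion.symm ▸ hmem),
    hpreimage, Measure.real,
    measure_iUnion₀ hnull fun k => (hcompact k).measurableSet.nullMeasurableSet, tsum_fintype,
    ENNReal.toReal_sum fun k _ => (hcompact k).measure_ne_top, Finset.mul_sum]
  refine Finset.sum_congr rfl fun k _ => ?_
  rw [normalizedVolume_eq_of_isUnimodular hg (hrange.trans (hspan k).symm) (p := p)]
  · rfl
  · exact fun q hq => hspan k ▸ hmem q (Set.mem_iUnion_of_mem k hq)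

open scoped Pointwise in
/-- The pyramid of height one over `Q`: the convex hull of the copy of `Q` at height zero and the
unit vector of the additional coordinate `none`, which is the height. -/
def pyramid {ι : Type*} (Q : Set (ι → ℝ)) : Set (Option ι → ℝ) :=
  {y | y none ∈ Set.Icc 0 1 ∧ (fun i => y (some i)) ∈ (1 - y none) • Q}

theorem isCompact_pyramid {ι : Type*} {Q : Set (ι → ℝ)} (hQ : IsCompact Q) :
    IsCompact (pyramid Q) := by
  let cone : ℝ × (ι → ℝ) → Option ι → ℝ := fun z o => o.elim z.1 fun i => (1 - z.1) * z.2 i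
  have hcone : Continuous cone := continuous_pi fun o => by
    cases o <;> simp only [cone, Option.elim] <;> fun_prop
  convert ((isCompact_Icc (a := (0 : ℝ)) (b := 1)).prod hQ).image hcone using 1
  ext y
  constructor
  · rintro ⟨ht, q, hq, hy⟩
    exact ⟨(y none, q), ⟨ht, hq⟩, funext fun o => o.rec rfl fun i => congrFun hy i⟩
  · rintro ⟨⟨t, q⟩, ⟨ht, hq⟩, rfl⟩
    exact ⟨ht, q, hq, rfl⟩

theorem lintegral_one_sub_pow (d : ℕ) :
    ∫⁻ t in Set.Icc (0 : ℝ) 1, ENNReal.ofReal ((1 - t) ^ d) = ENNReal.ofReal (1 / (d + 1)) := by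
  rw [← ofReal_integral_eq_lintegral_ofReal]
  · rw [integral_Icc_eq_integral_Ioc, ← intervalIntegral.integral_of_le zero_le_one,
      intervalIntegral.integral_comp_sub_left (fun x => x ^ d) 1, integral_pow]
    simp
  · exact Continuous.integrableOn_Icc (by fun_prop)
  · filter_upwards [ae_restrict_mem measurableSet_Icc] with t ht
    exact pow_nonneg (by linarith [ht.2]) _

open scoped Pointwise in
theorem volume_pyramid {S : Set (κ → ℝ)} (hS : MeasurableSet (pyramid S)) :
    volume (pyramid S) = ENNReal.ofReal (1 / (Fintype.card κ + 1)) * volume S := by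
  let e := (MeasurableEquiv.piOptionEquivProd fun _ : Option κ => ℝ).symm
  have he : volume (pyramid S) = volume (e ⁻¹' pyramid S) := by
    rw [volume_pi, ← Measure.pi_map_piOptionEquivProd fun _ : Option κ => (volume : Measure ℝ),
      MeasurableEquiv.map_apply]
    rfl
  have hslice : ∀ t, volume ((fun x => (x, t)) ⁻¹' (e ⁻¹' pyramid S))
      = (Set.Icc (0 : ℝ) 1).indicator
          (fun t => ENNReal.ofReal ((1 - t) ^ Fintype.card κ) * volume S) t := by
    intro t
    have hmem : (fun x => (x, t)) ⁻¹' (e ⁻¹' pyramid S)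
        = {x | t ∈ Set.Icc 0 1 ∧ x ∈ (1 - t) • S} := rfl
    by_cases ht : t ∈ Set.Icc (0 : ℝ) 1
    · have hpow : 0 ≤ (1 - t) ^ Fintype.card κ := pow_nonneg (sub_nonneg.2 ht.2) _
      rw [hmem, Set.indicator_of_mem ht]
      simp only [ht, true_and, Set.ofPred_mem_eq]
      rw [Measure.addHaar_smul, Module.finrank_fintype_fun_eq_card, abs_of_nonneg hpow]
    · rw [hmem, Set.indicator_of_notMem ht]
      simp [ht]
  rw [he, Measure.volume_eq_prod, Measure.prod_apply_symm (e.measurable hS),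
    lintegral_congr hslice, lintegral_indicator measurableSet_Icc,
    lintegral_mul_const _ (by fun_prop), lintegral_one_sub_pow]

omit [Fintype ι] in
theorem vectorSpan_pyramid {Q : Set (ι → ℝ)} {b : ι → ℝ} (hb : b ∈ Q) :
    vectorSpan ℝ (pyramid Q) = (vectorSpan ℝ Q).comap
      (LinearMap.funLeft ℝ ℝ some + (LinearMap.proj (none : Option ι)).smulRight b) := by
  set slope := LinearMap.funLeft ℝ ℝ some + (LinearMap.proj (none : Option ι)).smulRight b
  let lift : (ι → ℝ) →ₗ[ℝ] Option ι → ℝ := LinearMap.pi fun o => o.elim 0 LinearMap.proj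
  let apex : Option ι → ℝ := fun o => o.elim 1 0
  apply le_antisymm
  · have hslope : ∀ y ∈ pyramid Q, slope y - b ∈ vectorSpan ℝ Q := by
      rintro y ⟨-, q, hq, hy⟩
      have : slope y - b = (1 - y none) • (q - b) := by
        change (fun i => y (some i)) + y none • b - b = _
        rw [← hy]
        module
      exact this ▸ Submodule.smul_mem _ _ (vsub_mem_vectorSpan ℝ hq hb)
    rw [vectorSpan_def, Submodule.span_le]
    rintro _ ⟨y, hy, z, hz, rfl⟩
    simpa using Submodule.sub_mem _ (hslope y hy) (hslope z hz)
  · have hlift : lift '' Q ⊆ pyramid Q := by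
      rintro _ ⟨q, hq, rfl⟩
      exact ⟨by simp [lift], q, hq, funext fun i => by simp [lift]⟩
    have hapex : apex ∈ pyramid Q := ⟨by simp [apex], b, hb, funext fun i => by simp [apex]⟩
    have hmap : (vectorSpan ℝ Q).map lift ≤ vectorSpan ℝ (pyramid Q) :=
      lift.toAffineMap.map_vectorSpan.le.trans (vectorSpan_mono ℝ hlift)
    intro y hy
    have hdecomp : y = y none • (apex - lift b) + lift (slope y) := by
      ext o
      cases o <;> simp [apex, lift, slope, LinearMap.funLeft]
    rw [hdecomp]
    exact Submodule.add_mem _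
      (Submodule.smul_mem _ _ (vsub_mem_vectorSpan ℝ hapex (hlift ⟨b, hb, rfl⟩)))
      (hmap ⟨_, hy, rfl⟩)

/-- The extension of a parametrization `g` of the base of a pyramid to a parametrization of the
pyramid, whose additional coordinate moves the point `b` of the base towards the apex. -/
def tilt {ι κ : Type*} (g : (κ → ℝ) →ₗ[ℝ] ι → ℝ) (b : ι → ℝ) :
    (Option κ → ℝ) →ₗ[ℝ] Option ι → ℝ :=
  LinearMap.pi fun o => o.elim (LinearMap.proj none) fun i =>
    LinearMap.proj i ∘ₗ g ∘ₗ LinearMap.funLeft ℝ ℝ some - b i • LinearMap.proj none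

theorem tilt_some {ι κ : Type*} (g : (κ → ℝ) →ₗ[ℝ] ι → ℝ) (b : ι → ℝ) (y : Option κ → ℝ)
    (i : ι) : tilt g b y (some i) = g (fun j => y (some j)) i - b i * y none :=
  rfl

theorem isUnimodular_tilt {ι κ : Type*} {g : (κ → ℝ) →ₗ[ℝ] ι → ℝ} (hg : IsUnimodular g)
    {b : ι → ℝ} (hb : IsIntegerVector b) : IsUnimodular (tilt g b) where
  injective := by
    rw [← LinearMap.ker_eq_bot, LinearMap.ker_eq_bot']
    intro y hy
    have hnone : y none = 0 := congrFun hy none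
    have hg0 : g (fun j => y (some j)) = 0 := funext fun i => by
      have hi : tilt g b y (some i) = 0 := congrFun hy (some i)
      rwa [tilt_some, hnone, mul_zero, sub_zero] at hi
    exact funext fun o => o.rec hnone fun j => congrFun ((map_eq_zero_iff g hg.injective).1 hg0) j
  isIntegerVector_iff y := by
    constructor
    · intro h
      obtain ⟨m, hm⟩ : ∃ m : ℤ, y none = m := h none
      have hsome : IsIntegerVector fun j => y (some j) :=
        (hg.isIntegerVector_iff _).1 fun i => by
          obtain ⟨k, hk⟩ := h (some i)
          obtain ⟨l, hl⟩ := hb i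
          rw [tilt_some, hl, hm, sub_eq_iff_eq_add] at hk
          exact ⟨k + l * m, by exact_mod_cast hk⟩
      exact fun o => o.rec ⟨m, hm⟩ hsome
    · rintro h (_ | i)
      · exact h none
      · obtain ⟨m, hm⟩ := h none
        obtain ⟨k, hk⟩ := (hg.isIntegerVector_iff _).2 (fun j => h (some j)) i
        obtain ⟨l, hl⟩ := hb i
        exact ⟨k - l * m, by rw [tilt_some, hk, hl, hm]; push_cast; rfl⟩

theorem range_tilt {ι κ : Type*} (g : (κ → ℝ) →ₗ[ℝ] ι → ℝ) (b : ι → ℝ) :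
    LinearMap.range (tilt g b) = (LinearMap.range g).comap
      (LinearMap.funLeft ℝ ℝ some + (LinearMap.proj (none : Option ι)).smulRight b) := by
  ext y
  constructor
  · rintro ⟨x, rfl⟩
    refine ⟨fun j => x (some j), funext fun i => ?_⟩
    change _ = tilt g b x (some i) + x none * b i
    rw [tilt_some]
    ring
  · rintro ⟨x, hx⟩
    refine ⟨fun o => o.elim (y none) x, funext fun o => ?_⟩
    cases o with
    | none => rfl
    | some i =>
      have hxi : g x i = y (some i) + y none * b i := congrFun hx i
      change g x i - b i * y none = y (some i)
      rw [hxi]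
      ring

open scoped Pointwise in
theorem setOf_tilt_add_mem_pyramid {ι κ : Type*} {g : (κ → ℝ) →ₗ[ℝ] ι → ℝ}
    (hg : Function.Injective g) {Q : Set (ι → ℝ)} {b : ι → ℝ}
    (hQ : ∀ q ∈ Q, q - b ∈ LinearMap.range g) :
    {y | tilt g b y + (fun o => o.elim 0 b) ∈ pyramid Q} = pyramid {x | g x + b ∈ Q} := by
  ext y
  have hnone : tilt g b y none + 0 = y none := add_zero _
  have hsome : (fun i => tilt g b y (some i) + b i)
      = g (fun j => y (some j)) + (1 - y none) • b := funext fun i => by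
    rw [tilt_some, Pi.add_apply, Pi.smul_apply, smul_eq_mul]
    ring
  change (tilt g b y none + 0 ∈ _ ∧ (fun i => tilt g b y (some i) + b i)
    ∈ (1 - (tilt g b y none + 0)) • Q) ↔ _ ∧ _
  rw [hnone, hsome]
  refine and_congr_right fun _ => ⟨?_, ?_⟩
  · rintro ⟨q, hq, hqy⟩
    obtain ⟨x, hx⟩ := hQ q hq
    obtain rfl : q = g x + b := by rw [hx, sub_add_cancel]
    exact ⟨x, hq, hg (by simpa using hqy)⟩
  · rintro ⟨x, hx, hxy⟩
    exact ⟨g x + b, hx, by simp [← hxy]⟩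

theorem normalizedVolume_pyramid {Q : Set (ι → ℝ)} [IsZLattice ℝ (integerPoints (vectorSpan ℝ Q))]
    (hQ : IsCompact Q) {b : ι → ℝ} (hbQ : b ∈ Q) (hb : IsIntegerVector b) :
    normalizedVolume (pyramid Q) = normalizedVolume Q := by
  obtain ⟨g, hg, hrange⟩ := exists_isUnimodular_range_eq (vectorSpan ℝ Q)
  have hmem : ∀ q ∈ Q, q - b ∈ vectorSpan ℝ Q := fun q hq => vsub_mem_vectorSpan ℝ hq hbQ
  have hrange' : LinearMap.range (tilt g b) = vectorSpan ℝ (pyramid Q) := by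
    rw [range_tilt, hrange, vectorSpan_pyramid hbQ]
  have hbase : (fun o : Option ι => o.elim 0 b) ∈ pyramid Q :=
    ⟨by simp, b, hbQ, funext fun i => by simp⟩
  have hmeas := (isCompact_pyramid (isCompact_setOf_add_mem hQ hg.injective b)).measurableSet
  rw [normalizedVolume_eq_of_isUnimodular (isUnimodular_tilt hg hb) hrange'
      fun q hq => vsub_mem_vectorSpan ℝ hq hbase,
    setOf_tilt_add_mem_pyramid hg.injective (by rwa [hrange]),
    normalizedVolume_eq_of_isUnimodular hg hrange hmem, Measure.real, volume_pyramid hmeas,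
    Fintype.card_option, Nat.factorial_succ, ENNReal.toReal_mul,
    ENNReal.toReal_ofReal (by positivity), Measure.real]
  push_cast
  field_simp

omit [Fintype ι] in
theorem ratCast_mem_span_integerPoints [Finite ι] (V : Submodule ℝ (ι → ℝ)) (q : ι → ℚ)
    (hq : (fun i => (q i : ℝ)) ∈ V) :
    (⟨_, hq⟩ : V) ∈ Submodule.span ℝ (integerPoints V : Set V) := by
  obtain ⟨D, hD⟩ :=
    IsLocalization.exist_integer_multiples_of_finite (nonZeroDivisors ℤ) q
  have hD0 : ((D : ℤ) : ℝ) ≠ 0 := Int.cast_ne_zero.2 (nonZeroDivisors.coe_ne_zero D)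
  have hmem : ((D : ℤ) : ℝ) • (⟨_, hq⟩ : V) ∈ integerPoints V := fun i => by
    obtain ⟨k, hk⟩ := hD i
    have hki : (k : ℚ) = D * q i := by simpa using hk
    exact ⟨k, by simpa using (congrArg (Rat.cast : ℚ → ℝ) hki).symm⟩
  exact (Submodule.smul_mem_iff _ hD0).1 (Submodule.subset_span hmem)

theorem exists_eq_sum_mul_ratCast (x : ι → ℝ) :
    ∃ (m : ℕ) (c : Fin m → ℝ) (q : Fin m → ι → ℚ), (∀ i, x i = ∑ j, c j * q j i) ∧
      ∀ r : ι → ℤ, ∑ i, (r i : ℝ) * x i = 0 → ∀ j, ∑ i, (r i : ℚ) * q j i = 0 := by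
  let S := Submodule.span ℚ (Set.range x)
  have : Module.Finite ℚ S := FiniteDimensional.span_of_finite ℚ (Set.finite_range x)
  let b := Module.finBasis ℚ S
  let x' : ι → S := fun i => ⟨x i, Submodule.subset_span ⟨i, rfl⟩⟩
  refine ⟨_, fun j => b j, fun j i => b.coord j (x' i), fun i => ?_, fun r hr j => ?_⟩
  · have hi : ((∑ j, b.repr (x' i) j • b j : S) : ℝ) = x i := congrArg _ (b.sum_repr (x' i))
    rw [← hi, AddSubmonoidClass.coe_finsetSum]
    exact Finset.sum_congr rfl fun j _ => by
      rw [Submodule.coe_smul, Rat.smul_def, mul_comm]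
      rfl
  · have hx' : ∑ i, r i • x' i = 0 := Subtype.ext <| by
      rw [AddSubmonoidClass.coe_finsetSum, ZeroMemClass.coe_zero, ← hr]
      exact Finset.sum_congr rfl fun i _ => zsmul_eq_mul _ _
    have hj : b.coord j (∑ i, r i • x' i) = 0 := by rw [hx', map_zero]
    simpa only [map_sum, map_zsmul, zsmul_eq_mul] using hj

theorem isZLattice_integerPoints_ker {W : Type*} (A : Matrix W ι ℤ) :
    IsZLattice ℝ (integerPoints (LinearMap.ker (A.map (Int.cast : ℤ → ℝ)).mulVecLin)) := by
  set V := LinearMap.ker (A.map (Int.cast : ℤ → ℝ)).mulVecLin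
  have hV : ∀ x : ι → ℝ, x ∈ V ↔ ∀ w, ∑ i, (A w i : ℝ) * x i = 0 := fun x => funext_iff
  refine ⟨eq_top_iff.2 ?_⟩
  rintro ⟨x, hx⟩ -
  obtain ⟨m, c, q, hxq, hq⟩ := exists_eq_sum_mul_ratCast x
  have hqV : ∀ j, (fun i => (q j i : ℝ)) ∈ V := fun j => (hV _).2 fun w => by
    exact_mod_cast hq (A w) ((hV x).1 hx w) j
  have hsum : (⟨x, hx⟩ : V) = ∑ j, c j • (⟨_, hqV j⟩ : V) := by
    ext i
    simp [hxq]
  rw [hsum]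
  exact Submodule.sum_mem _ fun j _ =>
    Submodule.smul_mem _ _ (ratCast_mem_span_integerPoints V _ (hqV j))

omit [Fintype ι] in
theorem vectorSpan_nonneg_solutions_eq_ker [Finite ι] {W : Type*} [AddCommGroup W] [Module ℝ W]
    {A : (ι → ℝ) →ₗ[ℝ] W} {a : W} {f : ι → ℝ} (hf : ∀ i, 0 < f i) (hA : A f = a) :
    vectorSpan ℝ {x : ι → ℝ | (∀ i, 0 ≤ x i) ∧ A x = a} = LinearMap.ker A := by
  apply le_antisymm
  · rw [vectorSpan_def, Submodule.span_le]
    rintro _ ⟨x, hx, y, hy, rfl⟩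
    simp [hx.2, hy.2]
  · intro x hx
    rw [LinearMap.mem_ker] at hx
    have hpos : ∀ᶠ t : ℝ in nhds 0, ∀ i, 0 < t * x i + f i :=
      Filter.eventually_all.2 fun i =>
        ContinuousAt.eventually_lt (by fun_prop) (by fun_prop) (by simpa using hf i)
    obtain ⟨t, ht, ht0⟩ := ((hpos.filter_mono nhdsWithin_le_nhds).and
      (self_mem_nhdsWithin : _ ∈ nhdsWithin (0 : ℝ) (Set.Ioi 0))).exists
    have hmem := vsub_mem_vectorSpan ℝ
      (s := {x : ι → ℝ | (∀ i, 0 ≤ x i) ∧ A x = a}) (p₁ := t • x + f) (p₂ := f)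
      ⟨fun i => (ht i).le, by simp [hx, hA]⟩ ⟨fun i => (hf i).le, hA⟩
    rw [vsub_eq_sub, add_sub_cancel_right] at hmem
    exact (Submodule.smul_mem_iff _ (ne_of_gt ht0)).1 hmem

end NormalizedVolume

section FlowPolytope

variable {n : ℕ} {E E' : Type} [Fintype E] [Fintype E']

/-- The netflow of a flow on the signed graph whose edges `lab e` are indexed by `e : E`. -/
noncomputable def netflow (lab : E → SignedEdge n) : (E → ℝ) →ₗ[ℝ] Fin (n + 1) → ℝ :=
  Matrix.mulVecLin (Matrix.of fun v e => ((lab e).root v : ℝ))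

theorem netflow_apply (lab : E → SignedEdge n) (f : E → ℝ) (v : Fin (n + 1)) :
    netflow lab f v = ∑ e, ((lab e).root v : ℝ) * f e :=
  rfl

theorem netflow_single [DecidableEq E] (lab : E → SignedEdge n) (e : E) (c : ℝ) :
    netflow lab (Pi.single e c) = fun v => (lab e).root v * c := by
  ext v
  simp [netflow_apply, Pi.single_apply]

theorem netflow_comp (lab : E → SignedEdge n) (σ : E' ≃ E) (f : E → ℝ) :
    netflow (lab ∘ σ) (f ∘ σ) = netflow lab f :=
  funext fun v => σ.sum_comp fun e => ((lab e).root v : ℝ) * f e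

instance isZLattice_integerPoints_ker_netflow (lab : E → SignedEdge n) :
    IsZLattice ℝ (integerPoints (LinearMap.ker (netflow lab))) :=
  isZLattice_integerPoints_ker (Matrix.of fun v e => (lab e).root v)

/-- The flow polytope of the signed graph whose edges `lab e` are indexed by `e : E`; the index
type makes it possible to compare the flows on different graphs. -/
def labelledFlowPolytope (lab : E → SignedEdge n) (a : Fin (n + 1) → ℝ) : Set (E → ℝ) :=
  {f | (∀ e, 0 ≤ f e) ∧ netflow lab f = a}

/-- The existence of a strictly positive flow, which forces the flow polytope to have the full
dimension of the space of flows with netflow zero. -/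
def HasPositiveFlow (lab : E → SignedEdge n) (a : Fin (n + 1) → ℝ) : Prop :=
  ∃ f : E → ℝ, (∀ e, 0 < f e) ∧ netflow lab f = a

theorem vectorSpan_labelledFlowPolytope {lab : E → SignedEdge n} {a : Fin (n + 1) → ℝ}
    (h : HasPositiveFlow lab a) :
    vectorSpan ℝ (labelledFlowPolytope lab a) = LinearMap.ker (netflow lab) :=
  let ⟨_, hf, hfa⟩ := h
  vectorSpan_nonneg_solutions_eq_ker hf hfa

theorem isZLattice_vectorSpan_labelledFlowPolytope {lab : E → SignedEdge n} {a : Fin (n + 1) → ℝ}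
    (h : HasPositiveFlow lab a) :
    IsZLattice ℝ (integerPoints (vectorSpan ℝ (labelledFlowPolytope lab a))) := by
  rw [vectorSpan_labelledFlowPolytope h]
  infer_instance

omit [Fintype E] [Fintype E'] in
theorem isUnimodular_funCongrLeft (σ : E' ≃ E) :
    IsUnimodular (LinearEquiv.funCongrLeft ℝ ℝ σ).toLinearMap where
  injective := (LinearEquiv.funCongrLeft ℝ ℝ σ).injective
  isIntegerVector_iff x := σ.forall_congr_right (q := fun e => ∃ k : ℤ, x e = k)

theorem normalizedVolume_labelledFlowPolytope_comp {lab : E → SignedEdge n}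
    {a : Fin (n + 1) → ℝ} (h : HasPositiveFlow lab a) (σ : E' ≃ E) :
    normalizedVolume (labelledFlowPolytope (lab ∘ σ) a)
      = normalizedVolume (labelledFlowPolytope lab a) := by
  have := isZLattice_vectorSpan_labelledFlowPolytope h
  rw [← normalizedVolume_image (isUnimodular_funCongrLeft σ)]
  congr 1
  ext f
  obtain ⟨f, rfl⟩ := (LinearEquiv.funCongrLeft ℝ ℝ σ).surjective f
  rw [LinearEquiv.coe_toLinearMap, (LinearEquiv.funCongrLeft ℝ ℝ σ).injective.mem_set_image]
  exact and_congr (σ.forall_congr_right (q := fun e => 0 ≤ f e)) (by rw [← netflow_comp lab σ]; rfl)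

theorem exists_equiv_toType {α : Type*} [DecidableEq α] (lab : E → α) :
    ∃ σ : (Finset.univ.val.map lab).ToType ≃ E, ∀ e, lab (σ e) = e.1 := by
  classical
  have hcount : ∀ e : E, (Finset.univ : Finset E).val.count e = 1 := fun e =>
    Multiset.count_eq_one_of_mem Finset.univ.nodup (Finset.mem_univ e)
  let τ : E ≃ (Finset.univ : Finset E).val.ToType :=
    { toFun := fun e => ⟨e, ⟨0, by rw [hcount]; exact one_pos⟩⟩
      invFun := fun x => x.1
      left_inv := fun _ => rfl
      right_inv := fun ⟨e, i⟩ => by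
        have hi := i.isLt.trans_eq (hcount e)
        exact congrArg (Sigma.mk e) (Fin.ext (Nat.lt_one_iff.1 hi).symm) }
  have hτ : ∀ e, (τ.trans (Multiset.mapEquiv _ lab) e).1 = lab e := fun e =>
    Multiset.mapEquiv_apply _ lab (τ e)
  exact ⟨(τ.trans (Multiset.mapEquiv _ lab)).symm, fun e => by rw [← hτ, Equiv.apply_symm_apply]⟩

theorem normalizedVolume_flowPolytope {lab : E → SignedEdge n} {a : Fin (n + 1) → ℤ}
    (h : HasPositiveFlow lab fun v => (a v : ℝ)) :
    normalizedVolume (SignedGraph.flowPolytope (Finset.univ.val.map lab) a)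
      = normalizedVolume (labelledFlowPolytope lab fun v => (a v : ℝ)) := by
  obtain ⟨σ, hσ⟩ := exists_equiv_toType lab
  rw [← normalizedVolume_labelledFlowPolytope_comp h σ, show lab ∘ σ = fun e => e.1 from funext hσ]
  rfl

/-- The pairing of the root of an edge with the weights `n + 1, n, …, 1` on the vertices, which
is positive for every edge. -/
def SignedEdge.weight (e : SignedEdge n) : ℝ := ∑ u : Fin (n + 1), (n + 1 - u : ℝ) * e.root u

theorem SignedEdge.one_le_weight (e : SignedEdge n) : 1 ≤ e.weight := by
  have hsingle : ∀ i : Fin (n + 1), ∑ u : Fin (n + 1),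
      (n + 1 - u : ℝ) * ((Pi.single i 1 : Fin (n + 1) → ℤ) u : ℝ) = n + 1 - i := fun i => by
    simp [Pi.single_apply]
  have hle : ∀ i : Fin (n + 1), (i : ℝ) ≤ n := fun i => by exact_mod_cast i.is_le
  rcases e with ⟨i, j, hij⟩ | ⟨i, j, hij⟩
  · have hij' : (i : ℝ) + 1 ≤ j := by exact_mod_cast hij
    simp only [weight, root, Pi.sub_apply, Int.cast_sub, mul_sub, Finset.sum_sub_distrib, hsingle]
    linarith
  · simp only [weight, root, Pi.add_apply, Int.cast_add, mul_add, Finset.sum_add_distrib, hsingle]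
    linarith [hle i, hle j]

theorem sum_weight_mul (lab : E → SignedEdge n) (f : E → ℝ) :
    ∑ e, (lab e).weight * f e = ∑ u : Fin (n + 1), (n + 1 - u : ℝ) * netflow lab f u := by
  simp only [SignedEdge.weight, netflow_apply, Finset.mul_sum, Finset.sum_mul, mul_assoc]
  exact Finset.sum_comm

theorem weight_mul_le {lab : E → SignedEdge n} {a : Fin (n + 1) → ℝ} {f : E → ℝ}
    (hf : f ∈ labelledFlowPolytope lab a) (e : E) :
    (lab e).weight * f e ≤ ∑ u : Fin (n + 1), (n + 1 - u : ℝ) * a u := by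
  obtain ⟨hf, rfl⟩ := hf
  rw [← sum_weight_mul]
  exact Finset.single_le_sum (f := fun e => (lab e).weight * f e)
    (fun e _ => mul_nonneg (zero_le_one.trans (lab e).one_le_weight) (hf e)) (Finset.mem_univ e)

theorem le_of_mem_labelledFlowPolytope {lab : E → SignedEdge n} {a : Fin (n + 1) → ℝ} {f : E → ℝ}
    (hf : f ∈ labelledFlowPolytope lab a) (e : E) :
    f e ≤ ∑ u : Fin (n + 1), (n + 1 - u : ℝ) * a u :=
  (le_mul_of_one_le_left (hf.1 e) (lab e).one_le_weight).trans (weight_mul_le hf e)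

theorem isCompact_labelledFlowPolytope (lab : E → SignedEdge n) (a : Fin (n + 1) → ℝ) :
    IsCompact (labelledFlowPolytope lab a) :=
  isCompact_Icc.of_isClosed_subset
    ((isClosed_Ici (a := (0 : E → ℝ))).inter
      (isClosed_singleton.preimage (netflow lab).continuous_of_finiteDimensional))
    fun _ hf => ⟨hf.1, le_of_mem_labelledFlowPolytope hf⟩

theorem labelledFlowPolytope_zero (lab : E → SignedEdge n) : labelledFlowPolytope lab 0 = {0} := by
  refine Set.Subset.antisymm (fun f hf => funext fun e => le_antisymm ?_ (hf.1 e)) ?_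
  · simpa using le_of_mem_labelledFlowPolytope hf e
  · rintro _ rfl
    exact ⟨fun _ => le_rfl, map_zero _⟩

open scoped Pointwise in
theorem smul_labelledFlowPolytope {lab : E → SignedEdge n} {a : Fin (n + 1) → ℝ}
    (hne : (labelledFlowPolytope lab a).Nonempty) {c : ℝ} (hc : 0 ≤ c) :
    c • labelledFlowPolytope lab a = labelledFlowPolytope lab (c • a) := by
  obtain rfl | hc := hc.eq_or_lt
  · rw [Set.zero_smul_set hne, zero_smul, labelledFlowPolytope_zero, Set.singleton_zero]
  ext f
  rw [Set.mem_smul_set_iff_inv_smul_mem₀ hc.ne']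
  refine and_congr (forall_congr' fun e => ?_) ?_
  · exact mul_nonneg_iff_of_pos_left (inv_pos.2 hc)
  · rw [map_smul, inv_smul_eq_iff₀ hc.ne']

theorem cast_netflowTwo : (fun v => (netflowTwo n v : ℝ)) = Pi.single 0 2 := by
  ext v
  simp [netflowTwo, Pi.single_apply]

/-- A combination of the all-ones flow and of the paths `g u`, which absorb its netflow. -/
theorem hasPositiveFlow_of_paths {lab : E → SignedEdge n} {g : Fin (n + 1) → E → ℝ}
    (hsum : ∀ u, 0 ≤ netflow lab 1 u) (hzero : 0 < netflow lab 1 0)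
    (hg : ∀ u e, 0 ≤ g u e) (hgu : ∀ u, netflow lab (g u) = Pi.single 0 1 - Pi.single u 1)
    {c : ℝ} (hc : 0 < c) : HasPositiveFlow lab (Pi.single 0 c) := by
  set b := netflow lab 1
  have hs : 0 < ∑ u, b u := Finset.sum_pos' (fun u _ => hsum u) ⟨0, Finset.mem_univ 0, hzero⟩
  have hnetflow : netflow lab (1 + ∑ u, b u • g u) = Pi.single 0 (∑ u, b u) := by
    have hb : ∑ u, b u • (Pi.single u 1 : Fin (n + 1) → ℝ) = b := by
      ext v
      simp [Pi.single_apply]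
    have h0 : (∑ u, b u) • (Pi.single 0 1 : Fin (n + 1) → ℝ) = Pi.single 0 (∑ u, b u) := by
      rw [← Pi.single_smul, smul_eq_mul, mul_one]
    simp only [map_add, map_sum, map_smul, hgu, smul_sub, Finset.sum_sub_distrib, hb,
      ← Finset.sum_smul, h0]
    exact add_sub_cancel _ _
  refine ⟨(c / ∑ u, b u) • (1 + ∑ u, b u • g u), fun e => ?_, ?_⟩
  · have : 0 ≤ ∑ u, b u * g u e := Finset.sum_nonneg fun u _ => mul_nonneg (hsum u) (hg u e)
    simp only [Pi.smul_apply, Pi.add_apply, Pi.one_apply, Finset.sum_apply, smul_eq_mul]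
    positivity
  · rw [map_smul, hnetflow, ← Pi.single_smul, smul_eq_mul, div_mul_cancel₀ _ hs.ne']

end FlowPolytope

theorem earlierVertex_injective {n : ℕ} (v : Fin n) : Function.Injective (earlierVertex v) :=
  fun i j h => by simpa [earlierVertex, Fin.ext_iff] using h

theorem exists_earlierVertex_eq {n : ℕ} {v : Fin n} {i : Fin (n + 1)} (h : i < v.succ) :
    ∃ i', earlierVertex v i' = i :=
  ⟨⟨i, by simpa [Fin.lt_def] using h⟩, rfl⟩

theorem exists_mem_Icc_sum_Iio_sum_Iic {m : ℕ} {g : Fin (m + 1) → ℝ} {c : ℝ} (hc : 0 ≤ c)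
    (hcg : c ≤ ∑ i, g i) :
    ∃ k, c ∈ Set.Icc (∑ i ∈ Finset.Iio k, g i) (∑ i ∈ Finset.Iic k, g i) := by
  by_contra! h
  have hlt : ∀ k, ∑ i ∈ Finset.Iic k, g i < c := fun k => by
    induction k using Fin.induction with
    | zero =>
      have hIio : Finset.Iio (0 : Fin (m + 1)) = ∅ := Finset.Iio_bot
      exact not_le.1 fun hle => h 0 ⟨by rwa [hIio, Finset.sum_empty], hle⟩
    | succ k ih =>
      have hIio : Finset.Iio k.succ = Finset.Iic k.castSucc := by
        ext i
        simp [Fin.lt_def, Fin.le_def]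
      exact not_le.1 fun hle => h k.succ ⟨hIio ▸ ih.le, hle⟩
  have hlast : Finset.Iic (Fin.last m) = Finset.univ := by
    ext i
    simp [Fin.le_last]
  exact (hlast ▸ hlt (Fin.last m)).not_ge hcg

/-- The edges of the complete signed graph other than the loop at the first vertex: the positive
and the negative edge between `v.succ` and an earlier vertex `i`, and the loop at `v.succ`. The
same type indexes the edges of the graphs of the family. -/
inductive EdgeIndex (n : ℕ) : Type
  | pos (v : Fin n) (i : Fin (v + 1)) : EdgeIndex n
  | neg (v : Fin n) (i : Fin (v + 1)) : EdgeIndex n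
  | loop (v : Fin n) : EdgeIndex n
  deriving DecidableEq, Fintype

namespace EdgeIndex

variable {n : ℕ}

/-- The positive edge between `v.succ` and the earlier vertex `i`. -/
def posEdge (v : Fin n) (i : Fin (v + 1)) : SignedEdge n :=
  .pos (earlierVertex v i) v.succ (earlierVertex_lt v i).le

/-- The negative edge between `v.succ` and the earlier vertex `i`. -/
def negEdge (v : Fin n) (i : Fin (v + 1)) : SignedEdge n :=
  .neg (earlierVertex v i) v.succ (earlierVertex_lt v i)

/-- The edge of the complete signed graph with a given index. -/
def label : EdgeIndex n → SignedEdge n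
  | pos v i => posEdge v i
  | neg v i => negEdge v i
  | loop v => .pos v.succ v.succ le_rfl

/-- The edges of the complete signed graph, where `none` is the index of the loop at the first
vertex. -/
def completeLabel : Option (EdgeIndex n) → SignedEdge n
  | none => .pos 0 0 le_rfl
  | some e => label e

/-- The edge with a given index of the graph of the family that belongs to the choice `k`. The
edges `(i, v, -)` with `i` before `k v` are replaced by second copies of `(i, v, +)`, and the loop
at `v` is replaced by a second copy of `(k v, v, +)`. -/
def familyLabel (k : (v : Fin n) → Fin (v + 1)) : EdgeIndex n → SignedEdge n
  | pos v i => posEdge v i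
  | neg v i => if i < k v then posEdge v i else negEdge v i
  | loop v => posEdge v (k v)

theorem sum_edgeIndex {M : Type*} [AddCommMonoid M] (F : EdgeIndex n → M) :
    ∑ e, F e = ∑ v : Fin n, (∑ i, (F (pos v i) + F (neg v i)) + F (loop v)) := by
  let σ : (v : Fin n) × (Fin (v + 1) ⊕ Fin (v + 1) ⊕ Unit) ≃ EdgeIndex n :=
    { toFun
        | ⟨v, .inl i⟩ => pos v i
        | ⟨v, .inr (.inl i)⟩ => neg v i
        | ⟨v, .inr (.inr _)⟩ => loop v
      invFun
        | pos v i => ⟨v, .inl i⟩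
        | neg v i => ⟨v, .inr (.inl i)⟩
        | loop v => ⟨v, .inr (.inr ())⟩
      left_inv := by rintro ⟨v, i | i | _⟩ <;> rfl
      right_inv := by rintro (_ | _ | _) <;> rfl }
  rw [← σ.sum_comp, Fintype.sum_sigma]
  refine Finset.sum_congr rfl fun v _ => ?_
  rw [Fintype.sum_sum_type, Fintype.sum_sum_type, Finset.sum_add_distrib, add_assoc]
  simp [σ]

theorem completeLabel_bijective : Function.Bijective (completeLabel (n := n)) := by
  have hne : ∀ (v : Fin n) (i : Fin (v + 1)), earlierVertex v i ≠ v.succ :=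
    fun v i => (earlierVertex_lt v i).ne
  constructor
  · rintro (_ | v | v | v) (_ | w | w | w) h
    all_goals
      simp only [completeLabel, label, posEdge, negEdge, SignedEdge.pos.injEq,
        SignedEdge.neg.injEq, reduceCtorEq, Fin.succ_inj] at h
    any_goals obtain ⟨h, rfl⟩ := h
    all_goals grind [Fin.succ_ne_zero, earlierVertex_injective, Function.Injective]
  · rintro (⟨i, j, h⟩ | ⟨i, j, h⟩)
    · obtain ⟨v, rfl⟩ := Fin.exists_succ_eq.2 (Fin.ne_zero_of_lt h)
      obtain ⟨i, rfl⟩ := exists_earlierVertex_eq h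
      exact ⟨some (neg v i), rfl⟩
    · obtain rfl | ⟨v, rfl⟩ := Fin.eq_zero_or_eq_succ j
      · obtain rfl : i = 0 := Fin.le_zero_iff.1 h
        exact ⟨none, rfl⟩
      · obtain h | rfl := h.lt_or_eq
        · obtain ⟨i, rfl⟩ := exists_earlierVertex_eq h
          exact ⟨some (pos v i), rfl⟩
        · exact ⟨some (loop v), rfl⟩

theorem completeGraphC_eq_map : completeGraphC n = Finset.univ.val.map completeLabel := by
  rw [completeGraphC, ← Finset.map_univ_equiv (Equiv.ofBijective _ completeLabel_bijective)]
  rfl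

theorem sum_edgeSetS_eq_map (k : (v : Fin n) → Fin (v + 1)) :
    ∑ v, edgeSetS v (k v) = Finset.univ.val.map (familyLabel k) := by
  have hsum : Finset.univ.val.map (familyLabel k)
      = ∑ e, ({familyLabel k e} : Multiset (SignedEdge n)) := by
    rw [← Finset.sum_multiset_singleton (Finset.univ : Finset (EdgeIndex n))]
    exact (map_sum (Multiset.mapAddMonoidHom (familyLabel k)) _ _).trans (by simp)
  rw [hsum, sum_edgeIndex]
  refine Finset.sum_congr rfl fun v _ => ?_
  have hk : ({posEdge v (k v)} : Multiset (SignedEdge n))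
      = ∑ i, if i = k v then {posEdge v i} else 0 := by simp
  simp only [familyLabel]
  rw [hk, ← Finset.sum_add_distrib, edgeSetS]
  refine Finset.sum_congr rfl fun i _ => ?_
  simp only [← posEdge.eq_1, ← negEdge.eq_1]
  obtain h | rfl | h := lt_trichotomy i (k v)
  · simp only [h, h.ne, if_true, if_false, add_zero]
    rfl
  · simp only [lt_irrefl, if_true, if_false]
    rw [add_right_comm]
    rfl
  · simp only [h.not_gt, h.ne', if_false, add_zero]
    rfl

theorem negEdge_mem_map_familyLabel_iff {k : (v : Fin n) → Fin (v + 1)} {v : Fin n}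
    {i : Fin (v + 1)} :
    negEdge v i ∈ Finset.univ.val.map (familyLabel k) ↔ k v ≤ i := by
  rw [Multiset.mem_map]
  constructor
  · rintro ⟨w | w | w, -, he⟩
    · simp [familyLabel, posEdge, negEdge] at he
    · simp only [familyLabel] at he
      split_ifs at he with hi
      · simp [posEdge, negEdge] at he
      · simp only [negEdge, SignedEdge.neg.injEq, Fin.succ_inj] at he
        obtain ⟨hiv, rfl⟩ := he
        exact earlierVertex_injective _ hiv ▸ not_lt.1 hi
    · simp [familyLabel, posEdge, negEdge] at he
  · exact fun h => ⟨neg v i, Finset.mem_univ _, if_neg h.not_gt⟩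

theorem sum_edgeSetS_injective :
    Function.Injective fun k : (v : Fin n) → Fin (v + 1) => ∑ v, edgeSetS v (k v) := by
  intro k l h
  simp only [sum_edgeSetS_eq_map] at h
  funext v
  refine eq_of_forall_ge_iff fun i => ?_
  rw [← negEdge_mem_map_familyLabel_iff, h, negEdge_mem_map_familyLabel_iff]

theorem root_posEdge (v : Fin n) (i : Fin (v + 1)) :
    (posEdge v i).root = Pi.single (earlierVertex v i) 1 + Pi.single v.succ 1 :=
  rfl

theorem root_negEdge (v : Fin n) (i : Fin (v + 1)) :
    (negEdge v i).root = Pi.single (earlierVertex v i) 1 - Pi.single v.succ 1 :=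
  rfl

theorem root_label_loop (v : Fin n) :
    (label (loop v)).root = Pi.single v.succ 1 + Pi.single v.succ 1 :=
  rfl

theorem netflow_label_apply (f : EdgeIndex n → ℝ) (u : Fin (n + 1)) :
    netflow label f u = ∑ v : Fin n,
      (∑ i, (if earlierVertex v i = u then f (pos v i) + f (neg v i) else 0) +
        if v.succ = u then ∑ i, (f (pos v i) - f (neg v i)) + 2 * f (loop v) else 0) := by
  rw [netflow_apply, sum_edgeIndex]
  refine Finset.sum_congr rfl fun v _ => ?_
  rw [root_label_loop]
  simp only [label, root_posEdge, root_negEdge, Pi.add_apply, Pi.sub_apply, Pi.single_apply,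
    eq_comm (a := u), Int.cast_add, Int.cast_sub, Int.cast_ite, Int.cast_one, Int.cast_zero]
  by_cases hv : v.succ = u
  · simp only [hv, if_true, add_mul, sub_mul, ite_mul, one_mul, zero_mul]
    rw [← two_mul, ← add_assoc (∑ i, _), ← Finset.sum_add_distrib]
    refine congrArg (· + _) (Finset.sum_congr rfl fun i _ => ?_)
    split_ifs <;> ring
  · simp only [hv, if_false, add_zero, sub_zero, zero_mul]
    refine Finset.sum_congr rfl fun i _ => ?_
    split_ifs <;> ring

theorem loop_le_sum_neg {f : EdgeIndex n → ℝ} (hf : ∀ e, 0 ≤ f e) {v : Fin n}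
    (hv : netflow label f v.succ ≤ 0) : f (loop v) ≤ ∑ i, f (neg v i) := by
  have hpos : 0 ≤ ∑ i, f (pos v i) := Finset.sum_nonneg fun i _ => hf _
  have houtflow : 0 ≤ ∑ w : Fin n, ∑ i,
      if earlierVertex w i = v.succ then f (pos w i) + f (neg w i) else 0 :=
    Finset.sum_nonneg fun w _ => Finset.sum_nonneg fun i _ => by
      split_ifs
      exacts [add_nonneg (hf _) (hf _), le_rfl]
  rw [netflow_label_apply, Finset.sum_add_distrib] at hv
  simp only [Fin.succ_inj, Finset.sum_ite_eq', Finset.mem_univ, if_true,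
    Finset.sum_sub_distrib] at hv
  linarith [hf (loop v)]

/-- The isomorphism from the flows on a graph of the family to the flows on the complete signed
graph without the loop at the first vertex, which replaces each second copy of a positive edge
`(i, v, +)` by the edge `(i, v, -)` followed by the loop at `v`. -/
def flowChange (k : (v : Fin n) → Fin (v + 1)) : (EdgeIndex n → ℝ) ≃ₗ[ℝ] EdgeIndex n → ℝ where
  toFun g
    | pos v i => g (pos v i)
    | neg v i => g (neg v i) + if i = k v then g (loop v) else 0
    | loop v => g (loop v) + ∑ j ∈ Finset.Iio (k v), g (neg v j)
  invFun f
    | pos v i => f (pos v i)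
    | neg v i => f (neg v i) -
        if i = k v then f (loop v) - ∑ j ∈ Finset.Iio (k v), f (neg v j) else 0
    | loop v => f (loop v) - ∑ j ∈ Finset.Iio (k v), f (neg v j)
  map_add' f g := by
    ext (⟨v, i⟩ | ⟨v, i⟩ | v)
    · rfl
    · simp only [Pi.add_apply]
      split_ifs <;> ring
    · simp only [Pi.add_apply, Finset.sum_add_distrib]
      ring
  map_smul' c f := by
    ext (⟨v, i⟩ | ⟨v, i⟩ | v)
    · rfl
    · simp [mul_add]
    · simp [mul_add, Finset.mul_sum]
  left_inv g := by
    have hsum : ∀ v, (∑ j ∈ Finset.Iio (k v), (g (neg v j) + if j = k v then g (loop v) else 0))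
        = ∑ j ∈ Finset.Iio (k v), g (neg v j) := fun v =>
      Finset.sum_congr rfl fun j hj => by rw [if_neg (Finset.mem_Iio.1 hj).ne, add_zero]
    ext (⟨v, i⟩ | ⟨v, i⟩ | v) <;> simp [hsum]
  right_inv f := by
    have hsum : ∀ v (c : ℝ), (∑ j ∈ Finset.Iio (k v), (f (neg v j) - if j = k v then c else 0))
        = ∑ j ∈ Finset.Iio (k v), f (neg v j) := fun v c =>
      Finset.sum_congr rfl fun j hj => by rw [if_neg (Finset.mem_Iio.1 hj).ne, sub_zero]
    ext (⟨v, i⟩ | ⟨v, i⟩ | v) <;> simp [hsum]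

theorem netflow_label_flowChange (k : (v : Fin n) → Fin (v + 1)) (g : EdgeIndex n → ℝ) :
    netflow label (flowChange k g) = netflow (familyLabel k) g := by
  ext u
  rw [netflow_apply, netflow_apply, sum_edgeIndex, sum_edgeIndex]
  refine Finset.sum_congr rfl fun v _ => ?_
  set loopRoot := (((label (loop v)).root u : ℤ) : ℝ) with hloopRoot
  have hpos : ∀ i, ((posEdge v i).root u : ℝ) = (negEdge v i).root u + loopRoot := fun i => by
    simp only [hloopRoot, root_posEdge, root_negEdge, root_label_loop, Pi.add_apply, Pi.sub_apply,
      Int.cast_add, Int.cast_sub]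
    ring
  have hneg : ∀ i, ((familyLabel k (neg v i)).root u : ℝ)
      = (negEdge v i).root u + if i < k v then loopRoot else 0 := fun i => by
    rw [familyLabel]
    split_ifs
    exacts [hpos i, (add_zero _).symm]
  have hIio : ∑ j ∈ Finset.Iio (k v), g (neg v j)
      = ∑ j, if j < k v then g (neg v j) else 0 := by
    rw [← Finset.sum_filter]
    congr 1
    ext j
    simp
  simp only [flowChange, LinearEquiv.coe_mk, LinearMap.coe_mk, AddHom.coe_mk, label, hIio, hneg]
  simp only [familyLabel, hpos, mul_add, add_mul, Finset.sum_add_distrib, Finset.mul_sum, mul_ite,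
    ite_mul, mul_zero, zero_mul, Finset.sum_ite_eq', Finset.mem_univ, if_true]
  ring

theorem isUnimodular_flowChange (k : (v : Fin n) → Fin (v + 1)) :
    IsUnimodular (flowChange k).toLinearMap where
  injective := (flowChange k).injective
  isIntegerVector_iff g := by
    have hint : ∀ f : EdgeIndex n → ℝ,
        IsIntegerVector f ↔ ∀ e, f e ∈ (Int.castRingHom ℝ).range := fun f =>
      forall_congr' fun e => exists_congr fun m => eq_comm
    rw [LinearEquiv.coe_toLinearMap]
    constructor
    · intro h
      rw [← (flowChange k).symm_apply_apply g]
      generalize flowChange k g = f at h ⊢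
      rw [hint] at h ⊢
      have hloop : ∀ v, f (loop v) - ∑ j ∈ Finset.Iio (k v), f (neg v j) ∈
          (Int.castRingHom ℝ).range := fun v => sub_mem (h _) (sum_mem fun j _ => h _)
      rintro (⟨v, i⟩ | ⟨v, i⟩ | v)
      · exact h _
      · exact sub_mem (h _) (by split_ifs; exacts [hloop v, zero_mem _])
      · exact hloop v
    · intro h
      rw [hint] at h ⊢
      rintro (⟨v, i⟩ | ⟨v, i⟩ | v)
      · exact h _
      · exact add_mem (h _) (by split_ifs; exacts [h _, zero_mem _])
      · exact add_mem (h _) (sum_mem fun j _ => h _)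

theorem flowChange_pos {k : (v : Fin n) → Fin (v + 1)} {g : EdgeIndex n → ℝ}
    (hg : ∀ e, 0 < g e) (e : EdgeIndex n) : 0 < flowChange k g e := by
  rcases e with ⟨v, i⟩ | ⟨v, i⟩ | v
  · exact hg _
  · exact add_pos_of_pos_of_nonneg (hg _) (by split_ifs; exacts [(hg _).le, le_rfl])
  · exact add_pos_of_pos_of_nonneg (hg _) (Finset.sum_nonneg fun _ _ => (hg _).le)

theorem exists_nonneg_netflow_eq_single_sub_single (k : (v : Fin n) → Fin (v + 1))
    (u : Fin (n + 1)) :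
    ∃ g : EdgeIndex n → ℝ, (∀ e, 0 ≤ g e) ∧
      netflow (familyLabel k) g = Pi.single 0 1 - Pi.single u 1 := by
  induction u using WellFoundedLT.induction with
  | ind u ih =>
    obtain rfl | ⟨v, rfl⟩ := Fin.eq_zero_or_eq_succ u
    · exact ⟨0, fun _ => le_rfl, by simp⟩
    · obtain ⟨g, hg, hgu⟩ := ih _ (earlierVertex_lt v (k v))
      refine ⟨g + Pi.single (neg v (k v)) 1,
        add_nonneg (a := g) hg (Pi.single_nonneg.2 zero_le_one), ?_⟩
      rw [map_add, netflow_single, hgu]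
      ext u
      simp [familyLabel, root_negEdge, Pi.single_apply]

theorem hasPositiveFlow_familyLabel [NeZero n] (k : (v : Fin n) → Fin (v + 1)) {c : ℝ}
    (hc : 0 < c) : HasPositiveFlow (familyLabel k) (Pi.single 0 c) := by
  choose g hg hgu using exists_nonneg_netflow_eq_single_sub_single k
  set f := flowChange k 1
  have hf : ∀ e, 0 < f e := flowChange_pos fun _ => one_pos
  have houtflow : ∀ u (v : Fin n) i,
      0 ≤ if earlierVertex v i = u then f (pos v i) + f (neg v i) else 0 := fun u v i => by
    split_ifs
    exacts [(add_pos (hf _) (hf _)).le, le_rfl]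
  have hinflow : ∀ v : Fin n, 0 ≤ ∑ i, (f (pos v i) - f (neg v i)) + 2 * f (loop v) := fun v => by
    have : (0 : ℝ) ≤ (Finset.Iio (k v)).card := Nat.cast_nonneg _
    simp only [f, flowChange, LinearEquiv.coe_mk, LinearMap.coe_mk, AddHom.coe_mk, Pi.one_apply,
      Finset.sum_const, nsmul_eq_mul, mul_one, sub_add_cancel_left, Finset.sum_neg_distrib,
      Finset.sum_ite_eq', Finset.mem_univ, if_true]
    linarith
  have hnonneg : ∀ u (v : Fin n), 0 ≤
      ∑ i, (if earlierVertex v i = u then f (pos v i) + f (neg v i) else 0) +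
        if v.succ = u then ∑ i, (f (pos v i) - f (neg v i)) + 2 * f (loop v) else 0 := fun u v =>
    add_nonneg (Finset.sum_nonneg fun i _ => houtflow u v i)
      (by split_ifs; exacts [hinflow v, le_rfl])
  refine hasPositiveFlow_of_paths (fun u => ?_) ?_ hg hgu hc
  · rw [← netflow_label_flowChange, netflow_label_apply]
    exact Finset.sum_nonneg fun v _ => hnonneg u v
  · rw [← netflow_label_flowChange, netflow_label_apply]
    have : earlierVertex (0 : Fin n) 0 = 0 := rfl
    refine Finset.sum_pos' (fun v _ => hnonneg 0 v) ⟨0, Finset.mem_univ _, ?_⟩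
    refine add_pos_of_pos_of_nonneg
      (Finset.sum_pos' (fun i _ => houtflow 0 0 i) ⟨0, Finset.mem_univ _, ?_⟩) ?_
    · rw [if_pos this]
      exact add_pos (hf _) (hf _)
    · rw [if_neg (Fin.succ_ne_zero _)]

theorem hasPositiveFlow_label_of_familyLabel {k : (v : Fin n) → Fin (v + 1)}
    {a : Fin (n + 1) → ℝ} (h : HasPositiveFlow (familyLabel k) a) :
    HasPositiveFlow (label (n := n)) a :=
  let ⟨g, hg, hga⟩ := h
  ⟨_, flowChange_pos hg, (netflow_label_flowChange k g).trans hga⟩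

theorem hasPositiveFlow_label [NeZero n] {c : ℝ} (hc : 0 < c) :
    HasPositiveFlow (label (n := n)) (Pi.single 0 c) :=
  hasPositiveFlow_label_of_familyLabel (hasPositiveFlow_familyLabel 0 hc)

theorem netflow_completeLabel (y : Option (EdgeIndex n) → ℝ) :
    netflow completeLabel y = Pi.single 0 (2 * y none) + netflow label fun e => y (some e) := by
  ext u
  rw [netflow_apply, Fintype.sum_option, Pi.add_apply, netflow_apply]
  congr 1
  by_cases hu : u = 0
  · simp [completeLabel, SignedEdge.root, hu, one_add_one_eq_two]
  · simp [completeLabel, SignedEdge.root, hu]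

theorem hasPositiveFlow_completeLabel [NeZero n] {c : ℝ} (hc : 0 < c) :
    HasPositiveFlow (completeLabel (n := n)) (Pi.single 0 c) := by
  obtain ⟨f, hf, hfc⟩ := hasPositiveFlow_label (n := n) (half_pos hc)
  refine ⟨Option.rec (c / 4) f, Option.rec (by positivity) hf, ?_⟩
  rw [netflow_completeLabel, hfc, ← Pi.single_add]
  congr 1
  ring

theorem exists_isIntegerVector_mem_labelledFlowPolytope [NeZero n] :
    ∃ b ∈ labelledFlowPolytope (label (n := n)) (Pi.single 0 2), IsIntegerVector b := by
  have hsingle : ∀ e e' : EdgeIndex n, (0 : ℝ) ≤ (Pi.single e 1 : EdgeIndex n → ℝ) e' :=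
    fun e => (Pi.single_nonneg.2 zero_le_one : (0 : EdgeIndex n → ℝ) ≤ Pi.single e 1)
  refine ⟨Pi.single (pos 0 0) 1 + Pi.single (neg 0 0) 1,
    ⟨fun e => add_nonneg (hsingle _ e) (hsingle _ e), ?_⟩, fun e => ?_⟩
  · have : earlierVertex (0 : Fin n) 0 = 0 := rfl
    ext u
    simp only [map_add, netflow_single, label, root_posEdge, root_negEdge, this, Pi.add_apply,
      Pi.sub_apply, Pi.single_apply, Int.cast_add, Int.cast_sub, Int.cast_ite, Int.cast_one,
      Int.cast_zero, mul_one, add_add_sub_cancel]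
    split_ifs <;> norm_num
  · refine ⟨(Pi.single (pos 0 0) 1 + Pi.single (neg 0 0) 1 : EdgeIndex n → ℤ) e, ?_⟩
    simp [Pi.single_apply]

theorem apply_none_le_one {y : Option (EdgeIndex n) → ℝ}
    (hy : y ∈ labelledFlowPolytope completeLabel (Pi.single 0 2)) : y none ≤ 1 := by
  have hweight : (completeLabel (n := n) none).weight = 2 * (n + 1) := by
    simp only [SignedEdge.weight, completeLabel, SignedEdge.root, Pi.add_apply, Pi.single_apply,
      Int.cast_add, Int.cast_ite, Int.cast_one, Int.cast_zero, mul_add, mul_ite, mul_one, mul_zero,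
      Finset.sum_add_distrib, Finset.sum_ite_eq', Finset.mem_univ, if_true, Fin.val_zero,
      Nat.cast_zero, sub_zero]
    ring
  have hbound := weight_mul_le hy none
  simp only [hweight, Pi.single_apply, mul_ite, mul_zero, Finset.sum_ite_eq', Finset.mem_univ,
    if_true, Fin.val_zero, Nat.cast_zero, sub_zero] at hbound
  rw [mul_comm _ (2 : ℝ)] at hbound
  exact (mul_le_iff_le_one_right (by positivity)).1 hbound

theorem labelledFlowPolytope_completeLabel [NeZero n] :
    labelledFlowPolytope (completeLabel (n := n)) (Pi.single 0 2)
      = pyramid (labelledFlowPolytope label (Pi.single 0 2)) := by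
  obtain ⟨b, hb, -⟩ := exists_isIntegerVector_mem_labelledFlowPolytope (n := n)
  have hsmul : ∀ t : ℝ, t • (Pi.single 0 2 : Fin (n + 1) → ℝ) = Pi.single 0 (2 * t) := fun t => by
    rw [← Pi.single_smul, smul_eq_mul, mul_comm]
  have hbase : ∀ y : Option (EdgeIndex n) → ℝ, netflow completeLabel y = Pi.single 0 2 ↔
      netflow label (fun e => y (some e)) = (1 - y none) • (Pi.single 0 2 : Fin (n + 1) → ℝ) :=
    fun y => by
      rw [netflow_completeLabel, ← hsmul, sub_smul, one_smul, eq_sub_iff_add_eq']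
  ext y
  constructor
  · intro hy
    have hle := apply_none_le_one hy
    refine ⟨⟨hy.1 none, hle⟩, ?_⟩
    rw [smul_labelledFlowPolytope ⟨b, hb⟩ (sub_nonneg.2 hle)]
    exact ⟨fun e => hy.1 _, (hbase y).1 hy.2⟩
  · rintro ⟨ht, hy⟩
    rw [smul_labelledFlowPolytope ⟨b, hb⟩ (sub_nonneg.2 ht.2)] at hy
    exact ⟨Option.rec ht.1 hy.1, (hbase y).2 hy.2⟩

theorem normalizedVolume_CRYC [NeZero n] :
    normalizedVolume (CRYC n)
      = normalizedVolume (labelledFlowPolytope (label (n := n)) (Pi.single 0 2)) := by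
  have hbase := isZLattice_vectorSpan_labelledFlowPolytope (hasPositiveFlow_label (n := n) two_pos)
  obtain ⟨b, hb, hbint⟩ := exists_isIntegerVector_mem_labelledFlowPolytope (n := n)
  have hcomplete := hasPositiveFlow_completeLabel (n := n) two_pos
  rw [← cast_netflowTwo] at hcomplete
  rw [CRYC, completeGraphC_eq_map, normalizedVolume_flowPolytope hcomplete, cast_netflowTwo,
    labelledFlowPolytope_completeLabel,
    normalizedVolume_pyramid (isCompact_labelledFlowPolytope _ _) hb hbint]

/-- The chamber of the base polytope that belongs to the choice `k`: the flow on the loop at each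
vertex `v` lies between the partial sums, before and after the edge `(k v, v, -)`, of the flows on
the negative edges into `v`. -/
def chamber (k : (v : Fin n) → Fin (v + 1)) (a : Fin (n + 1) → ℝ) : Set (EdgeIndex n → ℝ) :=
  {f ∈ labelledFlowPolytope label a | ∀ v, f (loop v) ∈
    Set.Icc (∑ j ∈ Finset.Iio (k v), f (neg v j)) (∑ j ∈ Finset.Iic (k v), f (neg v j))}

theorem sum_Iio_flowChange (k : (v : Fin n) → Fin (v + 1)) (g : EdgeIndex n → ℝ) (v : Fin n) :
    ∑ j ∈ Finset.Iio (k v), flowChange k g (neg v j) = ∑ j ∈ Finset.Iio (k v), g (neg v j) :=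
  Finset.sum_congr rfl fun j hj => by
    simp [flowChange, (Finset.mem_Iio.1 hj).ne]

theorem sum_Iic_flowChange (k : (v : Fin n) → Fin (v + 1)) (g : EdgeIndex n → ℝ) (v : Fin n) :
    ∑ j ∈ Finset.Iic (k v), flowChange k g (neg v j)
      = flowChange k g (loop v) + g (neg v (k v)) := by
  rw [← Finset.Iio_insert, Finset.sum_insert Finset.notMem_Iio_self, sum_Iio_flowChange]
  simp only [flowChange, LinearEquiv.coe_mk, LinearMap.coe_mk, AddHom.coe_mk, if_true]
  ring

theorem flowChange_mem_chamber_iff {k : (v : Fin n) → Fin (v + 1)} {a : Fin (n + 1) → ℝ}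
    {g : EdgeIndex n → ℝ} :
    flowChange k g ∈ chamber k a ↔ g ∈ labelledFlowPolytope (familyLabel k) a := by
  have hloop : ∀ v, flowChange k g (loop v) = g (loop v) + ∑ j ∈ Finset.Iio (k v), g (neg v j) :=
    fun v => rfl
  constructor
  · rintro ⟨⟨hnonneg, hflow⟩, hk⟩
    simp only [Set.mem_Icc, sum_Iic_flowChange, sum_Iio_flowChange, hloop,
      le_add_iff_nonneg_left, le_add_iff_nonneg_right] at hk
    refine ⟨?_, netflow_label_flowChange k g ▸ hflow⟩
    rintro (⟨v, i⟩ | ⟨v, i⟩ | v)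
    · exact hnonneg (pos v i)
    · obtain rfl | hi := eq_or_ne i (k v)
      · exact (hk v).2
      · simpa [flowChange, hi] using hnonneg (neg v i)
    · exact (hk v).1
  · rintro ⟨hnonneg, hflow⟩
    refine ⟨⟨?_, (netflow_label_flowChange k g).trans hflow⟩, fun v => ?_⟩
    · rintro (⟨v, i⟩ | ⟨v, i⟩ | v)
      · exact hnonneg _
      · exact add_nonneg (hnonneg _) (by split_ifs; exacts [hnonneg _, le_rfl])
      · exact add_nonneg (hnonneg _) (Finset.sum_nonneg fun _ _ => hnonneg _)
    · rw [sum_Iic_flowChange, sum_Iio_flowChange, hloop]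
      exact ⟨le_add_of_nonneg_left (hnonneg _), le_add_of_nonneg_right (hnonneg _)⟩

theorem chamber_eq_image (k : (v : Fin n) → Fin (v + 1)) (a : Fin (n + 1) → ℝ) :
    chamber k a = (flowChange k).toLinearMap '' labelledFlowPolytope (familyLabel k) a := by
  ext f
  obtain ⟨g, rfl⟩ := (flowChange k).surjective f
  rw [flowChange_mem_chamber_iff]
  exact (flowChange k).injective.mem_set_image.symm

theorem isCompact_chamber (k : (v : Fin n) → Fin (v + 1)) (a : Fin (n + 1) → ℝ) :
    IsCompact (chamber k a) := by
  rw [chamber_eq_image]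
  exact (isCompact_labelledFlowPolytope _ a).image
    (flowChange k).toLinearMap.continuous_of_finiteDimensional

theorem vectorSpan_chamber {k : (v : Fin n) → Fin (v + 1)} {a : Fin (n + 1) → ℝ}
    (h : HasPositiveFlow (familyLabel k) a) :
    vectorSpan ℝ (chamber k a) = LinearMap.ker (netflow label) := by
  have hker : LinearMap.ker (netflow (familyLabel k))
      = (LinearMap.ker (netflow label)).comap (flowChange k).toLinearMap := by
    ext g
    exact Eq.congr_left (netflow_label_flowChange k g).symm
  rw [chamber_eq_image, ← LinearMap.coe_toAffineMap, ← AffineMap.map_vectorSpan,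
    LinearMap.toAffineMap_linear, vectorSpan_labelledFlowPolytope h, hker,
    Submodule.map_comap_eq_of_surjective (flowChange k).surjective]

theorem normalizedVolume_chamber {k : (v : Fin n) → Fin (v + 1)} {a : Fin (n + 1) → ℝ}
    (h : HasPositiveFlow (familyLabel k) a) :
    normalizedVolume (chamber k a)
      = normalizedVolume (labelledFlowPolytope (familyLabel k) a) := by
  have := isZLattice_vectorSpan_labelledFlowPolytope h
  rw [chamber_eq_image, normalizedVolume_image (isUnimodular_flowChange k)]

theorem iUnion_chamber {a : Fin (n + 1) → ℝ} (ha : ∀ v : Fin n, a v.succ ≤ 0) :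
    ⋃ k, chamber k a = labelledFlowPolytope label a := by
  refine Set.Subset.antisymm (Set.iUnion_subset fun k f hf => hf.1) fun f hf => ?_
  have hloop : ∀ v, f (loop v) ≤ ∑ i, f (neg v i) := fun v =>
    loop_le_sum_neg hf.1 ((congrFun hf.2 v.succ).trans_le (ha v))
  choose k hk using fun v => exists_mem_Icc_sum_Iio_sum_Iic (hf.1 (loop v)) (hloop v)
  exact Set.mem_iUnion.2 ⟨k, hf, hk⟩

/-- Two chambers lie on different sides of the hyperplane where the flow on some loop equals a
partial sum of the flows on negative edges, and contain flows off this hyperplane. -/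
theorem vectorSpan_chamber_inter_chamber_ne {k l : (v : Fin n) → Fin (v + 1)} {v : Fin n}
    (hkl : k v < l v) {a : Fin (n + 1) → ℝ} (hk : HasPositiveFlow (familyLabel k) a)
    (hl : (chamber l a).Nonempty) :
    vectorSpan ℝ (chamber k a ∩ chamber l a) ≠ LinearMap.ker (netflow label) := by
  let excess : (EdgeIndex n → ℝ) →ₗ[ℝ] ℝ :=
    LinearMap.proj (loop v) - ∑ j ∈ Finset.Iic (k v), LinearMap.proj (neg v j)
  have hexcess : ∀ f, excess f = f (loop v) - ∑ j ∈ Finset.Iic (k v), f (neg v j) := fun f => by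
    simp [excess, LinearMap.sum_apply]
  have hnonpos : ∀ f ∈ chamber k a, excess f ≤ 0 := fun f hf =>
    (hexcess f).trans_le (sub_nonpos.2 (hf.2 v).2)
  have hnonneg : ∀ f ∈ chamber l a, 0 ≤ excess f := fun f hf => by
    rw [hexcess, sub_nonneg]
    refine le_trans (Finset.sum_le_sum_of_subset_of_nonneg ?_ fun _ _ _ => hf.1.1 _) (hf.2 v).1
    exact fun j hj => Finset.mem_Iio.2 ((Finset.mem_Iic.1 hj).trans_lt hkl)
  have hspan : vectorSpan ℝ (chamber k a ∩ chamber l a) ≤ LinearMap.ker excess := by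
    refine Submodule.span_le.2 ?_
    rintro _ ⟨f, hf, g, hg, rfl⟩
    have hzero : ∀ f ∈ chamber k a ∩ chamber l a, excess f = 0 := fun f hf =>
      (hnonpos f hf.1).antisymm (hnonneg f hf.2)
    exact (map_sub excess f g).trans (by rw [hzero f hf, hzero g hg, sub_zero])
  obtain ⟨g, hg, hga⟩ := hk
  obtain ⟨f, hf⟩ := hl
  have hneg : excess (flowChange k g) < 0 := by
    rw [hexcess, sum_Iic_flowChange, sub_add_cancel_left]
    exact neg_neg_of_pos (hg _)
  intro heq
  have hker : f - flowChange k g ∈ LinearMap.ker excess :=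
    hspan (heq ▸ LinearMap.mem_ker.2 (by
      rw [map_sub, netflow_label_flowChange, hga, hf.1.2, sub_self]))
  rw [LinearMap.mem_ker, map_sub] at hker
  linarith [hnonneg f hf]

theorem pairwise_vectorSpan_chamber_inter_chamber_ne {a : Fin (n + 1) → ℝ}
    (h : ∀ k : (v : Fin n) → Fin (v + 1), HasPositiveFlow (familyLabel k) a) :
    Pairwise fun k l : (v : Fin n) → Fin (v + 1) =>
      vectorSpan ℝ (chamber k a ∩ chamber l a) ≠ LinearMap.ker (netflow label) := by
  have hne : ∀ k, (chamber k a).Nonempty := fun k =>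
    let ⟨g, hg, hga⟩ := h k
    ⟨_, flowChange_mem_chamber_iff.2 ⟨fun e => (hg e).le, hga⟩⟩
  intro k l hkl
  obtain ⟨v, hv⟩ := Function.ne_iff.1 hkl
  obtain hv | hv := hv.lt_or_gt
  · exact vectorSpan_chamber_inter_chamber_ne hv (h k) (hne l)
  · rw [Set.inter_comm]
    exact vectorSpan_chamber_inter_chamber_ne hv (h l) (hne k)

theorem normalizedVolume_eq_sum_chamber {a : Fin (n + 1) → ℝ} (ha : ∀ v : Fin n, a v.succ ≤ 0)
    (h : ∀ k : (v : Fin n) → Fin (v + 1), HasPositiveFlow (familyLabel k) a) :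
    normalizedVolume (labelledFlowPolytope label a)
      = ∑ k, normalizedVolume (labelledFlowPolytope (familyLabel k) a) := by
  rw [← iUnion_chamber ha, normalizedVolume_iUnion (fun k => isCompact_chamber k a)
    (fun k => vectorSpan_chamber (h k))
    (by rw [iUnion_chamber ha, vectorSpan_labelledFlowPolytope 
      (hasPositiveFlow_label_of_familyLabel (h 0))])
    (pairwise_vectorSpan_chamber_inter_chamber_ne h)]
  exact Finset.sum_congr rfl fun k _ => normalizedVolume_chamber (h k)

end EdgeIndex

theorem theorem1 (n : ℕ) (hn : 1 ≤ n) :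
    normalizedVolume (CRYC n) =
      ∑ G ∈ graphFamily n, normalizedVolume (G.flowPolytope (netflowTwo n)) := by
  have : NeZero n := ⟨Nat.one_le_iff_ne_zero.1 hn⟩
  have hpos : ∀ k, HasPositiveFlow (EdgeIndex.familyLabel k) fun v => (netflowTwo n v : ℝ) :=
    fun k => cast_netflowTwo (n := n) ▸ EdgeIndex.hasPositiveFlow_familyLabel k two_pos
  have hle : ∀ v : Fin n, (netflowTwo n v.succ : ℝ) ≤ 0 := fun v => by simp [netflowTwo]
  rw [EdgeIndex.normalizedVolume_CRYC, ← cast_netflowTwo,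
    EdgeIndex.normalizedVolume_eq_sum_chamber hle hpos, graphFamily,
    Finset.sum_image EdgeIndex.sum_edgeSetS_injective.injOn]
  refine Finset.sum_congr rfl fun k _ => ?_
  rw [EdgeIndex.sum_edgeSetS_eq_map, normalizedVolume_flowPolytope (hpos k)]
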